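/- Let $k_1,k_2,k_3\ge 2$ be integers, $n=k_1+k_2+k_3$, and let $B$ be the Killing form of $\mathfrak{so}(n)$. Consider the decomposition of skew-symmetric matrices into blocks of sizes $k_1,k_2,k_3$, $$\mathfrak{so}(n)=\mathfrak{so}(k_1)\oplus\mathfrak{so}(k_2)\oplus\mathfrak{so}(k_3)\oplus\mathfrak m_{12}\oplus\mathfrak m_{13}\oplus\mathfrak m_{23},$$ where $\mathfrak{so}(k_i)$ is embedded as the $i$-th diagonal block and $\mathfrak m_{ij}$ consists of the matrices in $\mathfrak{so}(n)$ that vanish outside the blocks $(i,j)$ and $(j,i)$. For positive real numbers $x_1,x_2,x_3,x_{12},x_{13},x_{23}$ consider the left-invariant Riemannian metric on $\mathrm{SO}(n)$ determined by the scalar product $$\langle\cdot,\cdot\rangle=\sum_{i=1}^{3}x_i\,(-B)|_{\mathfrak{so}(k_i)}+x_{12}(-B)|_{\mathfrak m_{12}}+x_{13}(-B)|_{\mathfrak m_{13}}+x_{23}(-B)|_{\mathfrak m_{23}}$$ on $\mathfrak{so}(n)$. For a closed subgroup $L$ of $\mathrm{SO}(n)$ with Lie algebra $\mathfrak l$, let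 $\mathrm{SO}(n)\times L$ act on $\mathrm{SO}(n)$ by $(g,l)y=gyl^{-1}$. The isotropy group of the identity is $\Delta L=\{(l,l):l\in L\}$, with Lie algebra $\Delta\mathfrak l=\{(W,W):W\in\mathfrak l\}$. The metric is called naturally reductive with respect to $\mathrm{SO}(n)\times L$ if this action is isometric (equivalently, $\langle\cdot,\cdot\rangle$ is $\mathrm{Ad}(L)$-invariant) and there is an $\mathrm{Ad}(\Delta L)$-invariant complement $\mathfrak p$ of $\Delta\mathfrak l$ in $\mathfrak{so}(n)\oplus\mathfrak l$ such that $$\langle[X,Y]_{\mathfrak p},Z\rangle+\langle Y,[X,Z]_{\mathfrak p}\rangle=0\qquad\text{for all }X,Y,Z\in\mathfrak p,$$ where $[\cdot,\cdot]_{\mathfrak p}$ is the $\mathfrak p$-component of the bracket along $\Delta\mathfrak l$, and the scalar product on $\mathfrak p$ is the one induced by the identification $\mathfrak p\cong T_e\mathrm{SO}(n)=\mathfrak{so}(n)$, $(U,V)\mapsto U-V$. Then the metric is naturally reductive with respect to $\mathrm{SO}(n)\times L$ for some closed subgroup $L$ of $\mathrm{SO}(n)$ if and only if at least one of the following holds: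 1. $x_1=x_2=x_{12}$ and $x_{13}=x_{23}$; 2. $x_2=x_3=x_{23}$ and $x_{12}=x_{13}$; 3. $x_1=x_3=x_{13}$ and $x_{12}=x_{23}$; 4. $x_{12}=x_{13}=x_{23}$. -/

import Mathlib

open scoped Matrix

namespace SOMetric

attribute [local instance 100] LieRing.ofAssociativeRing

/-- The rotation group `SO(n)`, with the topology induced from the real `n × n` matrices. -/
abbrev SO (n : ℕ) : Type := Matrix.specialOrthogonalGroup (Fin n) ℝ

/-- The Lie algebra `𝔰𝔬(n)` of real skew-symmetric `n × n` matrices. -/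
abbrev so (n : ℕ) : LieSubalgebra ℝ (Matrix (Fin n) (Fin n) ℝ) :=
  LieAlgebra.Orthogonal.so (Fin n) ℝ

theorem SO.transpose_mul_self {n : ℕ} (g : SO n) :
    (g : Matrix (Fin n) (Fin n) ℝ)ᵀ * (g : Matrix (Fin n) (Fin n) ℝ) = 1 :=
  (Matrix.mem_orthogonalGroup_iff' (Fin n) ℝ).1
    (Matrix.mem_specialOrthogonalGroup_iff.1 g.2).1

theorem SO.mul_transpose_self {n : ℕ} (g : SO n) :
    (g : Matrix (Fin n) (Fin n) ℝ) * (g : Matrix (Fin n) (Fin n) ℝ)ᵀ = 1 :=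
  (Matrix.mem_orthogonalGroup_iff (Fin n) ℝ).1
    (Matrix.mem_specialOrthogonalGroup_iff.1 g.2).1

/-- The adjoint representation `Ad(g) X = g X g⁻¹` of `SO(n)` (here `g⁻¹ = gᵀ`). -/
def Ad {n : ℕ} (g : SO n) : so n →ₗ[ℝ] so n where
  toFun X := ⟨(g : Matrix (Fin n) (Fin n) ℝ) * (X : Matrix (Fin n) (Fin n) ℝ) *
      (g : Matrix (Fin n) (Fin n) ℝ)ᵀ, by
    have h := (LieAlgebra.Orthogonal.mem_so (Fin n) ℝ _).1 X.2
    rw [LieAlgebra.Orthogonal.mem_so]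
    simp [Matrix.transpose_mul, h, Matrix.mul_assoc]⟩
  map_add' X Y := by
    ext1
    simp [Matrix.mul_add, Matrix.add_mul]
  map_smul' c X := by
    ext1
    simp

/-! ### The Lie algebra of a closed subgroup -/

theorem norm_pow_sub_pow_le {R : Type*} [NormedRing R] [NormOneClass R] {a b : R}
    (ha : ‖a‖ ≤ 1) (hb : ‖b‖ ≤ 1) (m : ℕ) : ‖a ^ m - b ^ m‖ ≤ m * ‖a - b‖ := by
  induction m with
  | zero => simp
  | succ m ih =>
    have e : a ^ (m + 1) - b ^ (m + 1) = (a ^ m - b ^ m) * a + b ^ m * (a - b) := by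
      rw [pow_succ, pow_succ]; noncomm_ring
    have h1 : ‖(a ^ m - b ^ m) * a‖ ≤ m * ‖a - b‖ :=
      (norm_mul_le _ _).trans
        ((mul_le_mul ih ha (norm_nonneg _) (by positivity)).trans (by rw [mul_one]))
    have h2 : ‖b ^ m * (a - b)‖ ≤ ‖a - b‖ := by
      refine (norm_mul_le _ _).trans ?_
      have : ‖b ^ m‖ ≤ 1 := (norm_pow_le b m).trans (pow_le_one₀ (norm_nonneg _) hb)
      simpa using mul_le_mul_of_nonneg_right this (norm_nonneg (a - b))
    rw [e]
    refine (norm_add_le _ _).trans ?_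
    push_cast
    linarith

open scoped Matrix.Norms.L2Operator in
/-- The Lie product formula, for one-parameter groups of rotations. -/
theorem tendsto_exp_mul_exp_pow {n : ℕ} {A B : Matrix (Fin n) (Fin n) ℝ}
    (hA : A ∈ so n) (hB : B ∈ so n) :
    Filter.Tendsto
      (fun m : ℕ => (NormedSpace.exp (((m : ℝ) + 1)⁻¹ • A) *
        NormedSpace.exp (((m : ℝ) + 1)⁻¹ • B)) ^ (m + 1))
      Filter.atTop (nhds (NormedSpace.exp (A + B))) := by
  rcases isEmpty_or_nonempty (Fin n) with hn | hn
  · have hs : Subsingleton (Matrix (Fin n) (Fin n) ℝ) := inferInstance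
    exact tendsto_const_nhds.congr fun m => Subsingleton.elim _ _
  have hexp : ∀ X ∈ so n, ∀ t : ℝ, ‖NormedSpace.exp (t • X)‖ ≤ 1 := by
    intro X hX t
    have hX' : star X = -X := by
      rw [Matrix.star_eq_conjTranspose, Matrix.conjTranspose_eq_transpose_of_trivial]
      exact (LieAlgebra.Orthogonal.mem_so (Fin n) ℝ X).1 hX
    have hs : star (NormedSpace.exp (t • X)) = NormedSpace.exp (-(t • X)) := by
      rw [Matrix.star_eq_conjTranspose, ← Matrix.exp_conjTranspose,
        ← Matrix.star_eq_conjTranspose, star_smul, hX']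
      simp
    have hu : NormedSpace.exp (t • X) ∈ unitary (Matrix (Fin n) (Fin n) ℝ) := by
      rw [Unitary.mem_iff, hs]
      constructor
      · rw [← Matrix.exp_add_of_commute (-(t • X)) (t • X) (Commute.refl (t • X)).neg_left]
        simp
      · rw [← Matrix.exp_add_of_commute (t • X) (-(t • X)) (Commute.refl (t • X)).neg_right]
        simp
    exact (CStarRing.norm_of_mem_unitary hu).le
  have hAB : A + B ∈ so n := (so n).add_mem hA hB
  have hd : HasDerivAt (fun t : ℝ => NormedSpace.exp (t • A) * NormedSpace.exp (t • B)
      - NormedSpace.exp (t • (A + B))) 0 0 := by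
    have h1 := hasDerivAt_exp_smul_const (𝕂 := ℝ) A (0 : ℝ)
    have h2 := hasDerivAt_exp_smul_const (𝕂 := ℝ) B (0 : ℝ)
    have h3 := hasDerivAt_exp_smul_const (𝕂 := ℝ) (A + B) (0 : ℝ)
    have h4 := (h1.mul h2).sub h3
    convert! h4 using 1
    simp
  have hseq : Filter.Tendsto (fun m : ℕ => ((m : ℝ) + 1)⁻¹) Filter.atTop
      (nhdsWithin (0 : ℝ) {0}ᶜ) := by
    refine tendsto_nhdsWithin_iff.2 ⟨?_, Filter.Eventually.of_forall fun m => ?_⟩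
    · simpa [one_div] using tendsto_one_div_add_atTop_nhds_zero_nat (𝕜 := ℝ)
    · have : ((m : ℝ) + 1)⁻¹ ≠ 0 := by positivity
      simpa using this
  have hlim := (hd.tendsto_slope_zero.comp hseq).norm
  rw [tendsto_iff_norm_sub_tendsto_zero]
  refine squeeze_zero (fun _ => norm_nonneg _) (fun m => ?_) (by simpa using hlim)
  have hm : ((m : ℝ) + 1) ≠ 0 := by positivity
  have hpow : NormedSpace.exp (A + B)
      = NormedSpace.exp (((m : ℝ) + 1)⁻¹ • (A + B)) ^ (m + 1) := by
    rw [← Matrix.exp_nsmul, ← Nat.cast_smul_eq_nsmul ℝ, smul_smul]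
    push_cast
    rw [mul_inv_cancel₀ hm, one_smul]
  rw [hpow]
  refine (norm_pow_sub_pow_le ?_ (hexp _ hAB _) (m + 1)).trans (le_of_eq ?_)
  · refine (norm_mul_le _ _).trans ?_
    simpa using mul_le_mul (hexp A hA _) (hexp B hB _) (norm_nonneg _) zero_le_one
  · rw [norm_smul, Real.norm_of_nonneg (by positivity : (0 : ℝ) ≤ (m : ℝ) + 1), smul_add]
    push_cast
    rfl

/-- The matrices of the elements of a closed subgroup form a closed set of matrices. -/
theorem isClosed_coe_image {n : ℕ} {L : Subgroup (SO n)} (hL : IsClosed (L : Set (SO n))) :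
    IsClosed ((fun g : SO n => (g : Matrix (Fin n) (Fin n) ℝ)) '' (L : Set (SO n))) := by
  have hc : IsClosed
      (Matrix.specialOrthogonalGroup (Fin n) ℝ : Set (Matrix (Fin n) (Fin n) ℝ)) := by
    have : (Matrix.specialOrthogonalGroup (Fin n) ℝ : Set (Matrix (Fin n) (Fin n) ℝ)) =
        {A | A * Aᵀ = 1} ∩ {A | A.det = 1} := by
      ext A
      exact Matrix.mem_specialOrthogonalGroup_iff.trans
        (and_congr_left fun _ => Matrix.mem_orthogonalGroup_iff (Fin n) ℝ)
    rw [this]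
    exact (isClosed_eq (by fun_prop) continuous_const).inter
      (isClosed_eq (by fun_prop) continuous_const)
  exact hc.isClosedEmbedding_subtypeVal.isClosedMap _ hL

/-- `exp (t X) ∈ L` for all real `t`. -/
def ExpMem {n : ℕ} (L : Subgroup (SO n)) (X : so n) : Prop :=
  ∀ t : ℝ, ∃ g ∈ L, (g : Matrix (Fin n) (Fin n) ℝ) =
    NormedSpace.exp (t • (X : Matrix (Fin n) (Fin n) ℝ))

theorem ExpMem.smul {n : ℕ} {L : Subgroup (SO n)} {X : so n} (hX : ExpMem L X) (c : ℝ) :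
    ExpMem L (c • X) := fun t => by
  obtain ⟨g, hg, h⟩ := hX (t * c)
  exact ⟨g, hg, by rw [h, mul_smul]; rfl⟩

theorem ExpMem.zero {n : ℕ} (L : Subgroup (SO n)) : ExpMem L 0 := fun t =>
  ⟨1, L.one_mem, by simp⟩

theorem ExpMem.add {n : ℕ} {L : Subgroup (SO n)} (hL : IsClosed (L : Set (SO n))) {X Y : so n}
    (hX : ExpMem L X) (hY : ExpMem L Y) : ExpMem L (X + Y) := fun t => by
  have hlim := tendsto_exp_mul_exp_pow ((so n).smul_mem t X.2) ((so n).smul_mem t Y.2)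
  have hmem := (isClosed_coe_image hL).mem_of_tendsto hlim (Filter.Eventually.of_forall fun m => by
    obtain ⟨g, hg, hg'⟩ := hX (((m : ℝ) + 1)⁻¹ * t)
    obtain ⟨h, hh, hh'⟩ := hY (((m : ℝ) + 1)⁻¹ * t)
    refine ⟨(g * h) ^ (m + 1), L.pow_mem (L.mul_mem hg hh) _, ?_⟩
    simp [hg', hh', smul_smul])
  obtain ⟨g, hg, h⟩ := hmem
  exact ⟨g, hg, by rw [← smul_add] at h; exact h⟩

theorem ExpMem.ad {n : ℕ} {L : Subgroup (SO n)} {l : SO n} (hl : l ∈ L) {X : so n}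
    (hX : ExpMem L X) : ExpMem L (Ad l X) := fun t => by
  obtain ⟨g, hg, h⟩ := hX t
  refine ⟨l * g * l⁻¹, L.mul_mem (L.mul_mem hl hg) (L.inv_mem hl), ?_⟩
  have hinv : (l : Matrix (Fin n) (Fin n) ℝ)⁻¹ = (l : Matrix (Fin n) (Fin n) ℝ)ᵀ :=
    Matrix.inv_eq_left_inv l.transpose_mul_self
  have hu : IsUnit (l : Matrix (Fin n) (Fin n) ℝ) :=
    ⟨⟨l, (l : Matrix (Fin n) (Fin n) ℝ)ᵀ, l.mul_transpose_self, l.transpose_mul_self⟩, rfl⟩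
  have e := Matrix.exp_conj (l : Matrix (Fin n) (Fin n) ℝ)
    (t • (X : Matrix (Fin n) (Fin n) ℝ)) hu
  rw [hinv, ← h] at e
  have e2 : t • ((Ad l X : so n) : Matrix (Fin n) (Fin n) ℝ) =
      (l : Matrix (Fin n) (Fin n) ℝ) * (t • (X : Matrix (Fin n) (Fin n) ℝ)) *
        (l : Matrix (Fin n) (Fin n) ℝ)ᵀ := by
    simp [Ad]
  rw [e2, e]
  rfl

/-- The linear subspace `{X | exp (t X) ∈ L for all t}`. -/
def lieSubmodule {n : ℕ} (L : Subgroup (SO n)) (hL : IsClosed (L : Set (SO n))) :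
    Submodule ℝ (so n) where
  carrier := {X | ExpMem L X}
  add_mem' hX hY := hX.add hL hY
  zero_mem' := ExpMem.zero L
  smul_mem' c _ hX := hX.smul c

open scoped Matrix.Norms.L2Operator in
theorem ExpMem.lie {n : ℕ} {L : Subgroup (SO n)} (hL : IsClosed (L : Set (SO n))) {X Y : so n}
    (hX : ExpMem L X) (hY : ExpMem L Y) : ExpMem L ⁅X, Y⁆ := by
  set V : Submodule ℝ (Matrix (Fin n) (Fin n) ℝ) :=
    (lieSubmodule L hL).map (so n).toSubmodule.subtype with hV
  have hVc : IsClosed (V : Set (Matrix (Fin n) (Fin n) ℝ)) := V.closed_of_finiteDimensional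
  have hmem : ∀ t : ℝ, NormedSpace.exp (t • (X : Matrix (Fin n) (Fin n) ℝ)) *
      (Y : Matrix (Fin n) (Fin n) ℝ) *
        NormedSpace.exp (t • (-(X : Matrix (Fin n) (Fin n) ℝ))) ∈ V := by
    intro t
    obtain ⟨g, hg, h⟩ := hX t
    refine ⟨Ad g Y, hY.ad hg, ?_⟩
    have e : NormedSpace.exp (t • (-(X : Matrix (Fin n) (Fin n) ℝ))) =
        (g : Matrix (Fin n) (Fin n) ℝ)ᵀ := by
      have := (LieAlgebra.Orthogonal.mem_so (Fin n) ℝ _).1 X.2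
      rw [h, ← Matrix.exp_transpose, Matrix.transpose_smul, this]
    rw [e, ← h]
    rfl
  have hd : HasDerivAt (fun t : ℝ => NormedSpace.exp (t • (X : Matrix (Fin n) (Fin n) ℝ)) *
      (Y : Matrix (Fin n) (Fin n) ℝ) *
        NormedSpace.exp (t • (-(X : Matrix (Fin n) (Fin n) ℝ))))
      ((X : Matrix (Fin n) (Fin n) ℝ) * (Y : Matrix (Fin n) (Fin n) ℝ) -
        (Y : Matrix (Fin n) (Fin n) ℝ) * (X : Matrix (Fin n) (Fin n) ℝ)) 0 := by
    have h1 := hasDerivAt_exp_smul_const (𝕂 := ℝ) (X : Matrix (Fin n) (Fin n) ℝ) (0 : ℝ)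
    have h2 := hasDerivAt_exp_smul_const (𝕂 := ℝ) (-(X : Matrix (Fin n) (Fin n) ℝ)) (0 : ℝ)
    have h3 := (h1.mul_const (Y : Matrix (Fin n) (Fin n) ℝ)).mul h2
    convert! h3 using 1
    simp [sub_eq_add_neg]
  have hin := hVc.mem_of_tendsto hd.tendsto_slope_zero (Filter.Eventually.of_forall fun t =>
    V.smul_mem _ (V.sub_mem (hmem _) (hmem 0)))
  obtain ⟨Z, hZ, hZe⟩ := hin
  have : Z = ⁅X, Y⁆ := Subtype.ext hZe
  exact this ▸ hZ

/-- The Lie algebra `𝔩 = {X ∈ 𝔰𝔬(n) | exp (t X) ∈ L for all t ∈ ℝ}` of a closed subgroup `L` of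
`SO(n)`. -/
def lieAlgebra {n : ℕ} (L : Subgroup (SO n)) (hL : IsClosed (L : Set (SO n))) :
    LieSubalgebra ℝ (so n) where
  __ := lieSubmodule L hL
  lie_mem' hX hY := ExpMem.lie hL hX hY

/-! ### Natural reductivity -/

/-- The natural reductivity identity
`⟨[X, Y]_𝔪, Z⟩ + ⟨Y, [X, Z]_𝔪⟩ = 0` for all `X, Y, Z ∈ 𝔪`,
where `𝔤 = 𝔨 ⊕ 𝔪`, the subscript `𝔪` is the projection to `𝔪` along `𝔨`, and
`⟨·, ·⟩ = β` is a bilinear form on `𝔪`. -/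
def NaturalReductivityIdentity {𝔤 : Type*} [LieRing 𝔤] [LieAlgebra ℝ 𝔤] (𝔨 𝔪 : Submodule ℝ 𝔤)
    (h : IsCompl 𝔪 𝔨) (β : LinearMap.BilinForm ℝ 𝔪) : Prop :=
  ∀ X Y Z : 𝔪, β (𝔪.projectionOnto 𝔨 h ⁅(X : 𝔤), (Y : 𝔤)⁆) Z +
    β Y (𝔪.projectionOnto 𝔨 h ⁅(X : 𝔤), (Z : 𝔤)⁆) = 0

/-- `SO(n) × L` acts on `SO(n)` by `(g, l) y = g y l⁻¹`. The isotropy group of the identity is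
`{(l, l) | l ∈ L}`; its Lie algebra is `{(W, W) | W ∈ 𝔩} ⊆ 𝔰𝔬(n) × 𝔩`. -/
def isotropy {n : ℕ} (𝔩 : LieSubalgebra ℝ (so n)) : Submodule ℝ (so n × 𝔩) :=
  LinearMap.range (LinearMap.prod 𝔩.toSubmodule.subtype LinearMap.id)

/-- The differential at the identity of the orbit map `(g, l) ↦ g l⁻¹`, that is,
`(X, Y) ↦ X - Y`. Its kernel is the isotropy algebra, so it identifies any complement of the
isotropy algebra with the tangent space `𝔰𝔬(n)` of `SO(n)` at the identity. -/
def orbitMap {n : ℕ} (𝔩 : LieSubalgebra ℝ (so n)) : so n × 𝔩 →ₗ[ℝ] so n :=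
  LinearMap.fst ℝ (so n) 𝔩 - 𝔩.toSubmodule.subtype ∘ₗ LinearMap.snd ℝ (so n) 𝔩

/-- The adjoint action `(X, Y) ↦ (Ad(l) X, Ad(l) Y)` of the isotropy element `(l, l)` on
`𝔰𝔬(n) × 𝔩`. -/
def isotropyAd {n : ℕ} (L : Subgroup (SO n)) (hL : IsClosed (L : Set (SO n))) (l : L) :
    so n × lieAlgebra L hL →ₗ[ℝ] so n × lieAlgebra L hL :=
  LinearMap.prodMap (Ad (l : SO n))
    ((Ad (l : SO n)).restrict (p := (lieAlgebra L hL).toSubmodule)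
      (q := (lieAlgebra L hL).toSubmodule) fun _ hX => ExpMem.ad l.2 hX)

/-- Let `β` be a scalar product on `𝔰𝔬(n) = T_e SO(n)`. The left-invariant metric on `SO(n)`
determined by `β` is naturally reductive with respect to `SO(n) × L`, acting by
`(g, l) y = g y l⁻¹`, if

* the action is isometric: as the metric is left-invariant, this says that `β` is
  `Ad(L)`-invariant;
* the isotropy algebra has a complement `𝔪` in `𝔰𝔬(n) × 𝔩` which is invariant under the adjoint
  action of the isotropy group, such that the scalar product induced by the metric on
  `𝔪 ≅ T_e SO(n)` satisfies the natural reductivity identity. -/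
def IsNaturallyReductive {n : ℕ} (β : LinearMap.BilinForm ℝ (so n)) (L : Subgroup (SO n))
    (hL : IsClosed (L : Set (SO n))) : Prop :=
  (∀ l ∈ L, ∀ X Y : so n, β (Ad l X) (Ad l Y) = β X Y) ∧
  ∃ (𝔪 : Submodule ℝ (so n × lieAlgebra L hL)) (h : IsCompl 𝔪 (isotropy (lieAlgebra L hL))),
    (∀ l : L, ∀ p ∈ 𝔪, isotropyAd L hL l p ∈ 𝔪) ∧
    NaturalReductivityIdentity (isotropy (lieAlgebra L hL)) 𝔪 h
      (β.compl₁₂ ((orbitMap (lieAlgebra L hL)).domRestrict 𝔪)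
        ((orbitMap (lieAlgebra L hL)).domRestrict 𝔪))

/-! ### The metrics -/

/-- The block (`0`, `1` or `2`) of an index, for the partition of the `n` indices into the first
`k₁`, the next `k₂`, and the remaining ones. -/
def block (k₁ k₂ : ℕ) {n : ℕ} (i : Fin n) : Fin 3 :=
  if (i : ℕ) < k₁ then 0 else if (i : ℕ) < k₁ + k₂ then 1 else 2

/-- The projection of `𝔰𝔬(k₁ + k₂ + k₃)` to one of its six summands, which keeps the blocks
`(a, b)` and `(b, a)` of a matrix and replaces the other entries by `0`. For `a = b` the summand is
the subalgebra `𝔰𝔬(k_a)`; for `a ≠ b` it is the space `𝔪_{ab}` of skew-symmetric matrices that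
vanish outside the blocks `(a, b)` and `(b, a)`. -/
def blockProj (k₁ k₂ k₃ : ℕ) (a b : Fin 3) :
    so (k₁ + k₂ + k₃) →ₗ[ℝ] so (k₁ + k₂ + k₃) where
  toFun X := ⟨Matrix.of fun i j =>
      if (block k₁ k₂ i = a ∧ block k₁ k₂ j = b) ∨ (block k₁ k₂ i = b ∧ block k₁ k₂ j = a)
      then (X : Matrix (Fin (k₁ + k₂ + k₃)) (Fin (k₁ + k₂ + k₃)) ℝ) i j else 0, by
    rw [LieAlgebra.Orthogonal.mem_so]
    ext i j
    have h := congrFun (congrFun ((LieAlgebra.Orthogonal.mem_so _ ℝ _).1 X.2) i) j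
    simp only [Matrix.transpose_apply, Matrix.neg_apply] at h
    simp only [Matrix.transpose_apply, Matrix.neg_apply, Matrix.of_apply]
    by_cases hij : (block k₁ k₂ i = a ∧ block k₁ k₂ j = b) ∨
        (block k₁ k₂ i = b ∧ block k₁ k₂ j = a)
    · rw [if_pos hij, if_pos (hij.symm.imp And.symm And.symm), h]
    · rw [if_neg hij, if_neg fun h' => hij (h'.symm.imp And.symm And.symm), neg_zero]⟩
  map_add' X Y := by
    ext i j
    change (if _ then X.1 i j + Y.1 i j else _) = (if _ then _ else _) + (if _ then _ else _)
    split_ifs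
    · rfl
    · rw [add_zero]
  map_smul' c X := by
    ext i j
    change (if _ then c * X.1 i j else _) = c * (if _ then _ else _)
    split_ifs
    · rfl
    · rw [mul_zero]

/-- The form `(-B)|_V`, extended by `0` on the other summands, where `B` is the Killing form of
`𝔰𝔬(k₁ + k₂ + k₃)` and `V` is the summand with label `(a, b)`. -/
noncomputable def blockForm (k₁ k₂ k₃ : ℕ) (a b : Fin 3) :
    LinearMap.BilinForm ℝ (so (k₁ + k₂ + k₃)) :=
  (-killingForm ℝ (so (k₁ + k₂ + k₃))).compl₁₂ (blockProj k₁ k₂ k₃ a b) (blockProj k₁ k₂ k₃ a b)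

/-- The scalar product
`x₁ (-B)|_{𝔰𝔬(k₁)} + x₂ (-B)|_{𝔰𝔬(k₂)} + x₃ (-B)|_{𝔰𝔬(k₃)}
  + x₁₂ (-B)|_{𝔪₁₂} + x₁₃ (-B)|_{𝔪₁₃} + x₂₃ (-B)|_{𝔪₂₃}` on `𝔰𝔬(k₁ + k₂ + k₃)`. -/
noncomputable def blockMetric (k₁ k₂ k₃ : ℕ) (x₁ x₂ x₃ x₁₂ x₁₃ x₂₃ : ℝ) :
    LinearMap.BilinForm ℝ (so (k₁ + k₂ + k₃)) :=
  x₁ • blockForm k₁ k₂ k₃ 0 0 + x₂ • blockForm k₁ k₂ k₃ 1 1 + x₃ • blockForm k₁ k₂ k₃ 2 2 +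
    x₁₂ • blockForm k₁ k₂ k₃ 0 1 + x₁₃ • blockForm k₁ k₂ k₃ 0 2 + x₂₃ • blockForm k₁ k₂ k₃ 1 2

end SOMetric

/-!
Write the scalar product as `⟨ΛX, Y⟩`, where `⟨X, Y⟩ = -tr(XY)` and `Λ` multiplies the matrix
entries by positive weights `wᵢⱼ` which depend only on the blocks of `i` and `j`. This is possible as the
Killing form of `𝔰𝔬(n)` is `(n - 2) tr(XY)` (`killingForm_so`, `blockMetric_eq_weightedForm`).

A complement of the isotropy algebra in `𝔰𝔬(n) × 𝔩` is the set of all `(ψX, ψX - X)`, for a linear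
map `ψ` of `𝔰𝔬(n)` such that `ψ - 1` takes its values in `𝔩`. Since `ad W` is skew for all `W ∈ 𝔩`
(`form_lie_add_form_lie_eq_zero`), the natural reductivity identity reduces to
`[ψY, ΛZ] + [ψZ, ΛY] = 0` for all `Y`, `Z`. Thus `S = ψΛ⁻¹` satisfies `[SA, A] = 0` for all `A`, and
for `n ≥ 5` this forces `S` to be a scalar `c` (`exists_eq_smul_of_lie_add_lie_eq_zero`), so that
`ψ = cΛ`. Hence `cΛ - 1` takes its values in `𝔩`, and if `c wᵢⱼ ≠ 1`, the rotation generator of the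
`(i, j)`-plane lies in `𝔩`. Its bracket exchanges the planes `(i, k)` and `(j, k)` up to sign, and so
`wᵢₖ = wⱼₖ` for all other `k` (`IsNaturallyReductive.weight_eq`). If `c x₁₂ ≠ 1`, this gives
`x₁ = x₁₂ = x₂` and `x₁₃ = x₂₃`, because each block has at least two elements, and likewise for the
other two pairs; if there is no such pair, then `x₁₂ = x₁₃ = x₂₃`.

Conversely, in each of the four cases the blocks can be merged in such a way that `w` is constant
with some value `m` off the merged diagonal blocks, and depends only on the merged blocks. Then
`ψ = m⁻¹Λ` works, with `L` the group of the block diagonal rotations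
(`isNaturallyReductive_weightedForm`).
-/

open scoped Matrix

namespace SOMetric

attribute [local instance 100] LieRing.ofAssociativeRing

variable {n : ℕ}

/-! ### Skew-symmetric matrices -/

theorem coe_lie (X Y : so n) : ((⁅X, Y⁆ : so n) : Matrix (Fin n) (Fin n) ℝ) =
    X.1 * Y.1 - Y.1 * X.1 := rfl

theorem so_transpose (X : so n) : (X : Matrix (Fin n) (Fin n) ℝ)ᵀ = -X.1 :=
  (LieAlgebra.Orthogonal.mem_so (Fin n) ℝ _).1 X.2

theorem so_apply_swap (X : so n) (i j : Fin n) : X.1 j i = -X.1 i j :=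
  congrFun (congrFun (so_transpose X) i) j

/-! ### The Killing form of `𝔰𝔬(n)` -/

theorem trace_mul_so (X Y : so n) : (X.1 * Y.1).trace = - ∑ i, ∑ j, X.1 i j * Y.1 i j := by
  rw [← Finset.sum_neg_distrib]
  refine Finset.sum_congr rfl fun i _ => ?_
  rw [Matrix.diag_apply, Matrix.mul_apply, ← Finset.sum_neg_distrib]
  refine Finset.sum_congr rfl fun j _ => ?_
  rw [so_apply_swap Y i j, mul_neg]

/-- The projection `M ↦ (M - Mᵀ) / 2` of the matrices to the skew-symmetric ones. -/
noncomputable def skewPart (n : ℕ) : Matrix (Fin n) (Fin n) ℝ →ₗ[ℝ] so n where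
  toFun M := ⟨(2⁻¹ : ℝ) • (M - Mᵀ), by
    rw [LieAlgebra.Orthogonal.mem_so]
    simp only [Matrix.transpose_smul, Matrix.transpose_sub, Matrix.transpose_transpose]
    rw [← smul_neg, neg_sub]⟩
  map_add' M N := by
    ext i j
    change 2⁻¹ * ((M i j + N i j) - (M j i + N j i)) =
      2⁻¹ * (M i j - M j i) + 2⁻¹ * (N i j - N j i)
    ring
  map_smul' c M := by
    ext i j
    change 2⁻¹ * (c * M i j - c * M j i) = c * (2⁻¹ * (M i j - M j i))
    ring

theorem skewPart_coe (X : so n) : skewPart n X.1 = X := by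
  ext1
  change (2⁻¹ : ℝ) • (X.1 - X.1ᵀ) = X.1
  rw [so_transpose, sub_neg_eq_add, ← two_smul ℝ, smul_smul]
  norm_num

theorem trace_matrix_end (F : Matrix (Fin n) (Fin n) ℝ →ₗ[ℝ] Matrix (Fin n) (Fin n) ℝ) :
    LinearMap.trace ℝ _ F = ∑ i, ∑ j, F (Matrix.single i j 1) i j := by
  rw [LinearMap.trace_eq_matrix_trace ℝ (Matrix.stdBasis ℝ (Fin n) (Fin n)) F, Matrix.trace,
    Fintype.sum_prod_type]
  refine Finset.sum_congr rfl fun i _ => Finset.sum_congr rfl fun j _ => ?_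
  rw [Matrix.diag_apply, LinearMap.toMatrix_apply, Matrix.stdBasis_eq_single]
  rfl

/-- The trace of an endomorphism of `𝔰𝔬(n)` is that of its extension by `0` on the symmetric
matrices. -/
theorem trace_so_end (F : so n →ₗ[ℝ] so n) :
    LinearMap.trace ℝ _ F =
      ∑ i, ∑ j, (F (skewPart n (Matrix.single i j 1))).1 i j := by
  have h : F = skewPart n ∘ₗ ((so n).toSubmodule.subtype ∘ₗ F) := by
    ext1 X
    exact (skewPart_coe _).symm
  have := LinearMap.trace_comp_comm' (R := ℝ) (skewPart n) ((so n).toSubmodule.subtype ∘ₗ F)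
  rw [← h] at this
  rw [← this, trace_matrix_end]
  rfl

theorem mul_single_one_apply (A : Matrix (Fin n) (Fin n) ℝ) (a b p q : Fin n) :
    (A * Matrix.single a b (1 : ℝ)) p q = if b = q then A p a else 0 := by
  simp [Matrix.mul_apply, Matrix.single_apply, ite_and]

theorem single_one_mul_apply (A : Matrix (Fin n) (Fin n) ℝ) (a b p q : Fin n) :
    (Matrix.single a b (1 : ℝ) * A) p q = if a = p then A b q else 0 := by
  simp [Matrix.mul_apply, Matrix.single_apply, ite_and]

theorem mul_single_one_mul_apply (A B : Matrix (Fin n) (Fin n) ℝ) (a b p q : Fin n) :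
    (A * Matrix.single a b (1 : ℝ) * B) p q = A p a * B b q := by
  rw [Matrix.mul_apply]
  simp [mul_single_one_apply]

/-- The Killing form of `𝔰𝔬(n)` is `(n - 2) tr(XY)`: extend `ad X ∘ ad Y` by `0` on the symmetric
matrices and sum its diagonal entries over the matrix units. -/
theorem killingForm_so (X Y : so n) :
    killingForm ℝ (so n) X Y = ((n : ℝ) - 2) * (X.1 * Y.1).trace := by
  rw [killingForm_apply_apply, trace_so_end]
  -- the diagonal entry of the extension of `ad X ∘ ad Y` at the matrix unit `(i, j)`
  have key : ∀ i j, (((LieAlgebra.ad ℝ (so n) X) ∘ₗ (LieAlgebra.ad ℝ (so n) Y))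
      (skewPart n (Matrix.single i j 1))).1 i j = 2⁻¹ * (
      (X.1 * Y.1) i i + (Y.1 * X.1) j j - X.1 i i * Y.1 j j - Y.1 i i * X.1 j j
      - (if i = j then (X.1 * Y.1) i j + (Y.1 * X.1) i j else 0)
      + X.1 i j * Y.1 i j + Y.1 i j * X.1 i j) := by
    intro i j
    have e : (((LieAlgebra.ad ℝ (so n) X) ∘ₗ (LieAlgebra.ad ℝ (so n) Y))
      (skewPart n (Matrix.single i j 1))).1 = (2⁻¹ : ℝ) • (
        X.1 * Y.1 * (Matrix.single i j 1) - X.1 * (Matrix.single i j 1) * Y.1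
        - Y.1 * (Matrix.single i j 1) * X.1 + (Matrix.single i j 1) * (Y.1 * X.1)
        - X.1 * Y.1 * (Matrix.single j i 1) + X.1 * (Matrix.single j i 1) * Y.1
        + Y.1 * (Matrix.single j i 1) * X.1 - (Matrix.single j i 1) * (Y.1 * X.1)) := by
      change X.1 * (Y.1 * ((2⁻¹ : ℝ) • (Matrix.single i j 1 - (Matrix.single i j 1)ᵀ)) -
        ((2⁻¹ : ℝ) • (Matrix.single i j 1 - (Matrix.single i j 1)ᵀ)) * Y.1) -
        (Y.1 * ((2⁻¹ : ℝ) • (Matrix.single i j 1 - (Matrix.single i j 1)ᵀ)) -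
        ((2⁻¹ : ℝ) • (Matrix.single i j 1 - (Matrix.single i j 1)ᵀ)) * Y.1) * X.1 = _
      rw [Matrix.transpose_single]
      simp only [Matrix.mul_smul, Matrix.smul_mul, ← smul_sub]
      congr 1
      noncomm_ring
    rw [e]
    simp only [Matrix.smul_apply, Matrix.add_apply, Matrix.sub_apply, smul_eq_mul]
    congr 1
    simp only [mul_single_one_mul_apply, mul_single_one_apply, single_one_mul_apply]
    have h : i = j ↔ j = i := eq_comm
    by_cases hij : i = j
    · subst hij; simp; ring
    · simp [hij, h.not.1 hij]; ring
  have htr := trace_mul_so X Y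
  have htr' : ∑ i, (Y.1 * X.1) i i = (X.1 * Y.1).trace := Matrix.trace_mul_comm _ _
  have htr'' : ∑ i, (X.1 * Y.1) i i = (X.1 * Y.1).trace := rfl
  have hd : ∀ (Z : so n) i, Z.1 i i = 0 := fun Z i => by linarith [so_apply_swap Z i i]
  have hc : ∑ i, ∑ j, Y.1 i j * X.1 i j = ∑ i, ∑ j, X.1 i j * Y.1 i j := by
    simp only [mul_comm]
  simp only [key, hd, ← Finset.mul_sum, Finset.sum_add_distrib, Finset.sum_sub_distrib]
  simp only [Finset.sum_const, Finset.card_univ, Fintype.card_fin, nsmul_eq_mul, mul_zero,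
    Finset.sum_ite_eq, Finset.mem_univ, if_true, ← Finset.mul_sum, Finset.sum_add_distrib, htr',
    htr'', hc]
  linarith

/-! ### Weighted scalar products on `𝔰𝔬(n)` -/

/-- The bilinear form `∑ wᵢⱼ Xᵢⱼ Yᵢⱼ` on `𝔰𝔬(n)`. -/
def weightedForm (w : Fin n → Fin n → ℝ) : LinearMap.BilinForm ℝ (so n) :=
  LinearMap.mk₂ ℝ (fun X Y => ∑ i, ∑ j, w i j * (X.1 i j * Y.1 i j))
    (fun X X' Y => by
      simp only [← Finset.sum_add_distrib]
      refine Finset.sum_congr rfl fun i _ => Finset.sum_congr rfl fun j _ => ?_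
      change w i j * ((X.1 i j + X'.1 i j) * _) = _
      ring)
    (fun c X Y => by
      simp only [smul_eq_mul, Finset.mul_sum]
      refine Finset.sum_congr rfl fun i _ => Finset.sum_congr rfl fun j _ => ?_
      change w i j * ((c * X.1 i j) * _) = _
      ring)
    (fun X Y Y' => by
      simp only [← Finset.sum_add_distrib]
      refine Finset.sum_congr rfl fun i _ => Finset.sum_congr rfl fun j _ => ?_
      change w i j * (_ * (Y.1 i j + Y'.1 i j)) = _
      ring)
    (fun c X Y => by
      simp only [smul_eq_mul, Finset.mul_sum]
      refine Finset.sum_congr rfl fun i _ => Finset.sum_congr rfl fun j _ => ?_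
      change w i j * (_ * (c * Y.1 i j)) = _
      ring)

theorem weightedForm_apply (w : Fin n → Fin n → ℝ) (X Y : so n) :
    weightedForm w X Y = ∑ i, ∑ j, w i j * (X.1 i j * Y.1 i j) := rfl

/-- Entrywise multiplication of skew-symmetric matrices by a symmetric weight. -/
def scale (w : Fin n → Fin n → ℝ) (hw : ∀ i j, w i j = w j i) : so n →ₗ[ℝ] so n where
  toFun X := ⟨Matrix.of fun i j => w i j * X.1 i j, by
    rw [LieAlgebra.Orthogonal.mem_so]
    ext i j
    change w j i * X.1 j i = -(w i j * X.1 i j)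
    rw [hw j i, so_apply_swap X i j, mul_neg]⟩
  map_add' X Y := by
    ext i j
    exact mul_add _ _ _
  map_smul' c X := by
    ext i j
    exact mul_left_comm _ _ _

theorem scale_apply (w : Fin n → Fin n → ℝ) (hw : ∀ i j, w i j = w j i) (X : so n)
    (i j : Fin n) : (scale w hw X).1 i j = w i j * X.1 i j := rfl

theorem weightedForm_eq_trace_left (w : Fin n → Fin n → ℝ) (hw : ∀ i j, w i j = w j i)
    (X Y : so n) : weightedForm w X Y = -((scale w hw X).1 * Y.1).trace := by
  rw [trace_mul_so, neg_neg, weightedForm_apply]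
  simp only [scale_apply, mul_assoc]

theorem weightedForm_eq_trace_right (w : Fin n → Fin n → ℝ) (hw : ∀ i j, w i j = w j i)
    (X Y : so n) : weightedForm w X Y = -(X.1 * (scale w hw Y).1).trace := by
  rw [trace_mul_so, neg_neg, weightedForm_apply]
  simp only [scale_apply, mul_left_comm]

/-- Invariance of the trace form. -/
theorem trace_lie_mul (X Y Z : so n) :
    (⁅X, Y⁆.1 * Z.1).trace = (X.1 * ⁅Y, Z⁆.1).trace := by
  rw [coe_lie, coe_lie, sub_mul, mul_sub, Matrix.trace_sub, Matrix.trace_sub, ← mul_assoc,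
    ← mul_assoc]
  congr 1
  rw [mul_assoc, Matrix.trace_mul_comm]

/-- Nondegeneracy of the trace form on `𝔰𝔬(n)`, which is negative definite. -/
theorem eq_zero_of_trace_mul (X : so n) (h : ∀ Y : so n, (Y.1 * X.1).trace = 0) : X = 0 := by
  have h := h X
  rw [trace_mul_so, neg_eq_zero] at h
  have h1 := (Finset.sum_eq_zero_iff_of_nonneg fun i _ =>
    Finset.sum_nonneg fun j _ => mul_self_nonneg (X.1 i j)).1 h
  ext i j
  have h2 := (Finset.sum_eq_zero_iff_of_nonneg fun j _ => mul_self_nonneg (X.1 i j)).1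
    (h1 i (Finset.mem_univ _)) j (Finset.mem_univ _)
  exact mul_self_eq_zero.1 h2

/-! ### Linear maps `S` of `𝔰𝔬(n)` with `[S A, A] = 0` -/

/-- The skew-symmetric matrix with entry `1` at `(i, j)` and `-1` at `(j, i)`. -/
def skewSingle (i j : Fin n) : so n :=
  ⟨Matrix.single i j 1 - Matrix.single j i 1, by
    rw [LieAlgebra.Orthogonal.mem_so]
    simp⟩

theorem skewSingle_apply (i j p q : Fin n) : (skewSingle i j).1 p q =
    (if i = p ∧ j = q then 1 else 0) - (if j = p ∧ i = q then (1 : ℝ) else 0) := by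
  change (Matrix.single i j (1 : ℝ) - Matrix.single j i 1 : Matrix (Fin n) (Fin n) ℝ) p q = _
  rw [Matrix.sub_apply, Matrix.single_apply, Matrix.single_apply]

theorem lie_skewSingle_apply (X : so n) (a b p q : Fin n) : (⁅X, skewSingle a b⁆ : so n).1 p q =
    ((if b = q then X.1 p a else 0) - (if a = q then X.1 p b else 0)) -
    ((if a = p then X.1 b q else 0) - (if b = p then X.1 a q else 0)) := by
  rw [coe_lie]
  change (X.1 * (Matrix.single a b (1 : ℝ) - Matrix.single b a 1) -
    (Matrix.single a b (1 : ℝ) - Matrix.single b a 1) * X.1 :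
      Matrix (Fin n) (Fin n) ℝ) p q = _
  rw [mul_sub, sub_mul]
  simp only [Matrix.sub_apply, mul_single_one_apply, single_one_mul_apply]

theorem sum_skewSingle (X : so n) : X = ∑ i, ∑ j, (X.1 i j / 2) • skewSingle i j := by
  have h : X.1 = ∑ i, ∑ j, ((X.1 i j / 2) • Matrix.single i j (1 : ℝ) -
      (X.1 i j / 2) • Matrix.single j i (1 : ℝ)) := by
    simp only [Finset.sum_sub_distrib]
    ext p q
    simp only [Matrix.sub_apply, Matrix.sum_apply, Matrix.smul_apply, Matrix.single_apply, ite_and,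
      smul_eq_mul, mul_ite, mul_one, mul_zero]
    simp
    rw [so_apply_swap X p q]
    ring
  ext1
  refine h.trans ?_
  have e : (so n).toSubmodule.subtype (∑ i, ∑ j, (X.1 i j / 2) • skewSingle i j) = _ :=
    map_sum _ _ _
  refine Eq.trans ?_ e.symm
  refine Finset.sum_congr rfl fun i _ => ?_
  rw [map_sum]
  refine Finset.sum_congr rfl fun j _ => ?_
  exact (smul_sub _ _ _).symm

/-- For `n ≥ 5`, a linear map `S` of `𝔰𝔬(n)` with `[S A, A] = 0` for all `A` is a scalar; the
hypothesis is the polarized form of this identity. The bound is sharp: on `𝔰𝔬(4) = 𝔰𝔬(3) ⊕ 𝔰𝔬(3)`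
the two factors may be scaled independently. -/
theorem exists_eq_smul_of_lie_add_lie_eq_zero (hn : 5 ≤ n) (S : so n →ₗ[ℝ] so n)
    (hS : ∀ A B, ⁅S A, B⁆ + ⁅S B, A⁆ = 0) : ∃ c : ℝ, ∀ A, S A = c • A := by
  have ent : ∀ a b c d p q, (⁅S (skewSingle a b), skewSingle c d⁆ : so n).1 p q +
      (⁅S (skewSingle c d), skewSingle a b⁆ : so n).1 p q = 0 := fun a b c d p q =>
    congrFun (congrFun (congrArg Subtype.val (hS (skewSingle a b) (skewSingle c d))) p) q
  have hd : ∀ (Z : so n) i, Z.1 i i = 0 := fun Z i => by linarith [so_apply_swap Z i i]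
  have fresh : ∀ s : Finset (Fin n), s.card ≤ 4 → ∃ m, m ∉ s := fun s hs => by
    by_contra! h
    have : s = Finset.univ := Finset.eq_univ_iff_forall.2 h
    rw [this, Finset.card_univ, Fintype.card_fin] at hs
    omega
  -- As `S (skewSingle i j)` commutes with `skewSingle i j`, its entries in the rows and columns
  -- `i`, `j` vanish, except those at `(i, j)` and `(j, i)`.
  have h1 : ∀ i j p, i ≠ j → p ≠ i → p ≠ j → (S (skewSingle i j)).1 p i = 0 := by
    intro i j p hij hpi hpj
    have := ent i j i j p j
    rw [lie_skewSingle_apply] at this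
    simp [hij, hpi.symm, hpj.symm] at this
    linarith
  have h1' : ∀ i j p, i ≠ j → p ≠ i → p ≠ j → (S (skewSingle i j)).1 p j = 0 := by
    intro i j p hij hpi hpj
    have := ent i j i j p i
    rw [lie_skewSingle_apply] at this
    simp [hij.symm, hpi.symm, hpj.symm] at this
    linarith
  -- The entry at `(l, k)`, away from `i` and `j`, is detected by bracketing with
  -- `skewSingle k m` for a fifth index `m`.
  have h2 : ∀ i j k l, i ≠ j → k ≠ l → k ≠ i → k ≠ j → l ≠ i → l ≠ j →
      (S (skewSingle i j)).1 l k = 0 := by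
    intro i j k l hij hkl hki hkj hli hlj
    obtain ⟨m, hm⟩ := fresh {i, j, k, l} Finset.card_le_four
    simp only [Finset.mem_insert, Finset.mem_singleton, not_or] at hm
    have := ent i j k m l m
    rw [lie_skewSingle_apply, lie_skewSingle_apply] at this
    simp [hkl, hli.symm, hlj.symm, hm, Ne.symm hm.1, Ne.symm hm.2.1, Ne.symm hm.2.2.1] at this
    exact this
  -- bracketing `skewSingle i j` with `skewSingle j k` compares their eigenvalues
  have h3 : ∀ i j k, i ≠ j → j ≠ k → i ≠ k →
      (S (skewSingle i j)).1 i j = (S (skewSingle j k)).1 j k := by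
    intro i j k hij hjk hik
    have := ent i j j k i k
    rw [lie_skewSingle_apply, lie_skewSingle_apply] at this
    simp [hjk, hik, hij.symm, hik.symm] at this
    linarith
  have hneg : ∀ i j : Fin n, skewSingle j i = -skewSingle i j := fun i j =>
    Subtype.ext (neg_sub _ _).symm
  have h4 : ∀ i j, (S (skewSingle j i)).1 j i = (S (skewSingle i j)).1 i j := fun i j => by
    rw [hneg i j, map_neg]
    change -(S (skewSingle i j)).1 j i = _
    rw [so_apply_swap _ i j, neg_neg]
  have h5 : ∀ i j p q, i ≠ j → p ≠ q →
      (S (skewSingle i j)).1 i j = (S (skewSingle p q)).1 p q := by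
    intro i j p q hij hpq
    obtain ⟨m, hm⟩ := fresh {i, j, p, q} Finset.card_le_four
    simp only [Finset.mem_insert, Finset.mem_singleton, not_or] at hm
    obtain ⟨hmi, hmj, hmp, hmq⟩ := hm
    rw [h3 i j m hij (Ne.symm hmj) (Ne.symm hmi), h3 p q m hpq (Ne.symm hmq) (Ne.symm hmp)]
    rcases eq_or_ne j q with rfl | hjq
    · rfl
    · rw [h3 j m q (Ne.symm hmj) hmq hjq, h4]
  have h01 : (⟨0, by omega⟩ : Fin n) ≠ ⟨1, by omega⟩ := by simp
  refine ⟨(S (skewSingle ⟨0, by omega⟩ ⟨1, by omega⟩)).1 ⟨0, by omega⟩ ⟨1, by omega⟩, fun A => ?_⟩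
  set c := (S (skewSingle ⟨0, by omega⟩ ⟨1, by omega⟩)).1 ⟨0, by omega⟩ ⟨1, by omega⟩
  have hS' : ∀ i j, S (skewSingle i j) = c • skewSingle i j := by
    intro i j
    rcases eq_or_ne i j with rfl | hij
    · have : skewSingle i i = 0 := Subtype.ext (sub_self _)
      rw [this, map_zero, smul_zero]
    ext p q
    change _ = c * (skewSingle i j).1 p q
    rw [skewSingle_apply]
    have hc := h5 i j _ _ hij h01
    change _ = c at hc
    by_cases hpq : p = q
    · subst hpq
      rw [hd]
      have : ¬ (i = p ∧ j = p) := fun h => hij (h.1.trans h.2.symm)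
      have : ¬ (j = p ∧ i = p) := fun h => hij (h.2.trans h.1.symm)
      simp [*]
    by_cases hpi : p = i
    · subst hpi
      by_cases hqj : q = j
      · subst hqj
        simp [hij.symm, hc]
      · rw [so_apply_swap _ q p, h1 p j q hij (Ne.symm hpq) hqj]
        simp [hij.symm, Ne.symm hqj]
    by_cases hpj : p = j
    · subst hpj
      by_cases hqi : q = i
      · subst hqi
        rw [so_apply_swap _ q p, hc]
        simp [hij]
      · rw [so_apply_swap _ q p, h1' i p q hij hqi (Ne.symm hpq)]
        simp [hij, Ne.symm hqi]
    have hr : ((if i = p ∧ j = q then 1 else 0) - if j = p ∧ i = q then (1 : ℝ) else 0) = 0 := by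
      simp [Ne.symm hpi, Ne.symm hpj]
    rw [hr, mul_zero]
    by_cases hqi : q = i
    · subst hqi
      exact h1 q j p hij hpi hpj
    by_cases hqj : q = j
    · subst hqj
      exact h1' i q p hij hpi hpj
    exact h2 i j q p hij (Ne.symm hpq) hqi hqj hpi hpj
  rw [sum_skewSingle A]
  simp only [map_sum, map_smul, hS', Finset.smul_sum]
  refine Finset.sum_congr rfl fun i _ => Finset.sum_congr rfl fun j _ => smul_comm _ _ _

/-- The previous result, applied to `S = ψ ∘ Λ⁻¹` where `Λ` is `scale w`. -/
theorem exists_eq_scale_of_lie_add_lie_eq_zero (hn : 5 ≤ n) {w : Fin n → Fin n → ℝ}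
    (hw : ∀ i j, w i j = w j i) (hpos : ∀ i j, 0 < w i j) (ψ : so n →ₗ[ℝ] so n)
    (hψ : ∀ A B, ⁅ψ A, scale w hw B⁆ + ⁅ψ B, scale w hw A⁆ = 0) :
    ∃ c : ℝ, ∀ A, ψ A = c • scale w hw A := by
  have hw' : ∀ i j, (w i j)⁻¹ = (w j i)⁻¹ := fun i j => by rw [hw]
  have hl : ∀ A, scale w hw (scale (fun i j => (w i j)⁻¹) hw' A) = A := fun A => by
    ext i j
    exact mul_inv_cancel_left₀ (hpos i j).ne' _
  have hr : ∀ A, scale (fun i j => (w i j)⁻¹) hw' (scale w hw A) = A := fun A => by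
    ext i j
    exact inv_mul_cancel_left₀ (hpos i j).ne' _
  obtain ⟨c, hc⟩ := exists_eq_smul_of_lie_add_lie_eq_zero hn
    (ψ ∘ₗ scale (fun i j => (w i j)⁻¹) hw') fun A B => by
      have := hψ (scale (fun i j => (w i j)⁻¹) hw' A) (scale (fun i j => (w i j)⁻¹) hw' B)
      rwa [hl, hl] at this
  refine ⟨c, fun A => ?_⟩
  have := hc (scale w hw A)
  rwa [LinearMap.comp_apply, hr] at this

/-! ### Consequences of natural reductivity -/

theorem orbitMap_isotropy {𝔩 : LieSubalgebra ℝ (so n)} {p : so n × 𝔩} (hp : p ∈ isotropy 𝔩) :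
    orbitMap 𝔩 p = 0 := by
  obtain ⟨W, rfl⟩ := hp
  exact sub_self _

theorem orbitMap_projectionOnto {𝔩 : LieSubalgebra ℝ (so n)} {𝔪 : Submodule ℝ (so n × 𝔩)}
    (h : IsCompl 𝔪 (isotropy 𝔩)) (p : so n × 𝔩) :
    orbitMap 𝔩 (𝔪.projectionOnto (isotropy 𝔩) h p : so n × 𝔩) = orbitMap 𝔩 p := by
  have hp : p - (𝔪.projectionOnto (isotropy 𝔩) h p : so n × 𝔩) ∈ isotropy 𝔩 := by
    rw [← Submodule.projectionOnto_apply_eq_zero_iff h, map_sub, Submodule.projectionOnto_apply_left,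
      sub_self]
  have := orbitMap_isotropy hp
  rw [map_sub, sub_eq_zero] at this
  exact this.symm

/-- The projection along the isotropy algebra does not change the value of `orbitMap`, so it drops
out of the natural reductivity identity. -/
theorem naturalReductivityIdentity_iff (β : LinearMap.BilinForm ℝ (so n))
    {𝔩 : LieSubalgebra ℝ (so n)} {𝔪 : Submodule ℝ (so n × 𝔩)} (h : IsCompl 𝔪 (isotropy 𝔩)) :
    NaturalReductivityIdentity (isotropy 𝔩) 𝔪 h
      (β.compl₁₂ ((orbitMap 𝔩).domRestrict 𝔪) ((orbitMap 𝔩).domRestrict 𝔪)) ↔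
    ∀ p ∈ 𝔪, ∀ q ∈ 𝔪, ∀ r ∈ 𝔪, β (orbitMap 𝔩 ⁅p, q⁆) (orbitMap 𝔩 r) +
      β (orbitMap 𝔩 q) (orbitMap 𝔩 ⁅p, r⁆) = 0 := by
  constructor
  · intro H p hp q hq r hr
    have := H ⟨p, hp⟩ ⟨q, hq⟩ ⟨r, hr⟩
    simpa only [LinearMap.compl₁₂_apply, LinearMap.domRestrict_apply, orbitMap_projectionOnto]
      using this
  · intro H p q r
    have := H p p.2 q q.2 r r.2
    simpa only [LinearMap.compl₁₂_apply, LinearMap.domRestrict_apply, orbitMap_projectionOnto]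
      using this

open scoped Matrix.Norms.L2Operator in
/-- If `β` is `Ad(L)`-invariant, then `ad W` is skew for `β` for all `W` in the Lie algebra of `L`:
differentiate `β (Ad(exp tW) Y) (Ad(exp tW) Z)` at `t = 0`. -/
theorem form_lie_add_form_lie_eq_zero {β : LinearMap.BilinForm ℝ (so n)} {L : Subgroup (SO n)}
    (hβ : ∀ l ∈ L, ∀ X Y : so n, β (Ad l X) (Ad l Y) = β X Y) {W : so n} (hW : ExpMem L W)
    (Y Z : so n) : β ⁅W, Y⁆ Z + β Y ⁅W, Z⁆ = 0 := by
  set B := (β.compl₁₂ (skewPart n) (skewPart n)).toContinuousBilinearMap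
  have hBa : ∀ X Y : so n, B X.1 Y.1 = β X Y := fun X Y => by
    change β (skewPart n X.1) (skewPart n Y.1) = _
    rw [skewPart_coe, skewPart_coe]
  set u : so n → ℝ → Matrix (Fin n) (Fin n) ℝ := fun Y t =>
    NormedSpace.exp (t • W.1) * Y.1 * NormedSpace.exp (t • (-W.1)) with hu
  have hd : ∀ Y : so n, HasDerivAt (u Y) (⁅W, Y⁆ : so n).1 0 := fun Y => by
    have h1 := hasDerivAt_exp_smul_const (𝕂 := ℝ) W.1 (0 : ℝ)
    have h2 := hasDerivAt_exp_smul_const (𝕂 := ℝ) (-W.1) (0 : ℝ)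
    have h3 := (h1.mul_const Y.1).mul h2
    convert! h3 using 1
    simp [← sub_eq_add_neg]
    rfl
  have h0 : ∀ Y : so n, u Y 0 = Y.1 := fun Y => by simp [hu]
  have hAd : ∀ t, ∃ l ∈ L, ∀ Y : so n, u Y t = (Ad l Y).1 := fun t => by
    obtain ⟨g, hg, h⟩ := hW t
    refine ⟨g, hg, fun Y => ?_⟩
    have e : NormedSpace.exp (t • (-W.1)) = (g : Matrix (Fin n) (Fin n) ℝ)ᵀ := by
      rw [h, ← Matrix.exp_transpose, Matrix.transpose_smul, so_transpose]
    change _ * _ * _ = _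
    rw [e, ← h]
    rfl
  have hconst : (fun t => B (u Y t) (u Z t)) = fun _ => β Y Z := by
    funext t
    obtain ⟨l, hl, h⟩ := hAd t
    rw [h, h, hBa, hβ l hl]
  have hderiv := B.hasDerivAt_of_bilinear (fun _ => hd Y) (fun _ => hd Z)
  rw [hconst, h0, h0, hBa, hBa] at hderiv
  rw [add_comm]
  exact hderiv.unique (hasDerivAt_const _ _)

/-- If the metric `⟨ΛX, Y⟩`, with `Λ` the entrywise multiplication by `w`, is naturally reductive
with respect to `SO(n) × L`, then `cΛ - 1` maps `𝔰𝔬(n)` to the Lie algebra of `L` for some `c`. -/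
theorem IsNaturallyReductive.exists_scale (hn : 5 ≤ n) {w : Fin n → Fin n → ℝ}
    (hw : ∀ i j, w i j = w j i) (hpos : ∀ i j, 0 < w i j) {L : Subgroup (SO n)}
    {hL : IsClosed (L : Set (SO n))} (h : IsNaturallyReductive (weightedForm w) L hL) :
    ∃ c : ℝ, ∀ A : so n, ExpMem L (c • scale w hw A - A) := by
  obtain ⟨hinv, 𝔪, hc, -, hNR⟩ := h
  rw [naturalReductivityIdentity_iff] at hNR
  -- `ι X = (ψ X, ψ X - X)` is the element of `𝔪` over `X`
  set ι : so n →ₗ[ℝ] so n × (lieAlgebra L hL) :=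
    𝔪.projection (isotropy _) hc ∘ₗ LinearMap.inl ℝ (so n) (lieAlgebra L hL)
  have hιm : ∀ X, ι X ∈ 𝔪 := fun X => (𝔪.projectionOnto (isotropy _) hc (X, 0)).2
  have hιo : ∀ X, orbitMap _ (ι X) = X := fun X =>
    (orbitMap_projectionOnto hc (X, 0)).trans (sub_zero X)
  set ψ : so n →ₗ[ℝ] so n := LinearMap.fst ℝ (so n) (lieAlgebra L hL) ∘ₗ ι
  have hψ : ∀ X, ((ι X).2 : so n) = ψ X - X := fun X => by
    have : (ι X).1 - ((ι X).2 : so n) = X := hιo X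
    rw [eq_sub_iff_add_eq, add_comm, ← eq_sub_iff_add_eq]
    exact this.symm
  have hexp : ∀ X, ExpMem L (ψ X - X) := fun X => hψ X ▸ (ι X).2.2
  have hbr : ∀ X Y, orbitMap _ ⁅ι X, ι Y⁆ = ⁅X, ψ Y⁆ + ⁅ψ X - X, Y⁆ := fun X Y => by
    have : orbitMap _ ⁅ι X, ι Y⁆ = ⁅ψ X, ψ Y⁆ - ⁅((ι X).2 : so n), ((ι Y).2 : so n)⁆ := rfl
    rw [this, hψ, hψ]
    simp only [sub_lie, lie_sub]
    abel
  have key : ∀ A B, ⁅ψ A, scale w hw B⁆ + ⁅ψ B, scale w hw A⁆ = 0 := fun A B => by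
    refine eq_zero_of_trace_mul _ fun X => ?_
    have h1 := hNR _ (hιm X) _ (hιm A) _ (hιm B)
    rw [hbr, hbr, hιo, hιo] at h1
    have h2 := form_lie_add_form_lie_eq_zero hinv (hexp X) A B
    have h3 : weightedForm w ⁅X, ψ A⁆ B + weightedForm w A ⁅X, ψ B⁆ = 0 := by
      simp only [map_add, LinearMap.add_apply] at h1
      linarith
    rw [weightedForm_eq_trace_right w hw, weightedForm_eq_trace_left w hw,
      Matrix.trace_mul_comm (scale w hw A).1, trace_lie_mul, trace_lie_mul] at h3
    change (X.1 * (⁅ψ A, scale w hw B⁆.1 + ⁅ψ B, scale w hw A⁆.1)).trace = 0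
    rw [mul_add, Matrix.trace_add]
    linarith
  obtain ⟨c, hcψ⟩ := exists_eq_scale_of_lie_add_lie_eq_zero hn hw hpos ψ key
  exact ⟨c, fun A => hcψ A ▸ hexp A⟩

theorem weightedForm_skewSingle_self (w : Fin n → Fin n → ℝ) (hw : ∀ i j, w i j = w j i)
    {i j : Fin n} (hij : i ≠ j) :
    weightedForm w (skewSingle i j) (skewSingle i j) = 2 * w i j := by
  rw [weightedForm_eq_trace_right w hw]
  change -((Matrix.single i j (1 : ℝ) - Matrix.single j i 1) *
    (scale w hw (skewSingle i j)).1).trace = _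
  rw [sub_mul, Matrix.trace_sub, Matrix.trace_single_mul, Matrix.trace_single_mul]
  simp [scale_apply, skewSingle_apply, hij, hij.symm, hw j i]
  ring

/-- If `c wᵢⱼ ≠ 1`, then `skewSingle i j` lies in the Lie algebra of `L`, and the bracket with it
rotates `skewSingle i k` into `skewSingle j k`, so these have the same length. -/
theorem IsNaturallyReductive.weight_eq (hn : 5 ≤ n) {w : Fin n → Fin n → ℝ}
    (hw : ∀ i j, w i j = w j i) (hpos : ∀ i j, 0 < w i j) {L : Subgroup (SO n)}
    {hL : IsClosed (L : Set (SO n))} (h : IsNaturallyReductive (weightedForm w) L hL) :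
    ∃ c : ℝ, ∀ i j k, i ≠ j → j ≠ k → i ≠ k → c * w i j ≠ 1 → w i k = w j k := by
  obtain ⟨c, hc⟩ := h.exists_scale hn hw hpos
  refine ⟨c, fun i j k hij hjk hik hcw => ?_⟩
  -- `skewSingle i j` is an eigenvector of `cΛ - 1` with the nonzero eigenvalue `c wᵢⱼ - 1`
  have hW : ExpMem L (skewSingle i j) := by
    have h1 := (hc (skewSingle i j)).smul (c * w i j - 1)⁻¹
    convert h1 using 1
    ext p q
    change _ = (c * w i j - 1)⁻¹ * (c * (w p q * (skewSingle i j).1 p q) - (skewSingle i j).1 p q)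
    have h2 : w p q * (skewSingle i j).1 p q = w i j * (skewSingle i j).1 p q := by
      rw [skewSingle_apply]
      by_cases h1 : i = p ∧ j = q
      · rw [h1.1, h1.2]
      · by_cases h2 : j = p ∧ i = q
        · rw [h2.1, h2.2, hw]
        · simp [h1, h2]
    rw [h2]
    have := sub_ne_zero.2 hcw
    field_simp
  have e1 : ⁅skewSingle i j, skewSingle j k⁆ = skewSingle i k := by
    ext1
    rw [coe_lie]
    change (Matrix.single i j (1 : ℝ) - Matrix.single j i 1) *
      (Matrix.single j k 1 - Matrix.single k j 1) - (Matrix.single j k 1 - Matrix.single k j 1) *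
      (Matrix.single i j 1 - Matrix.single j i 1) = Matrix.single i k 1 - Matrix.single k i 1
    simp [mul_sub, sub_mul, hij, hjk, hik, hij.symm, hjk.symm, hik.symm]
  have e2 : ⁅skewSingle i j, skewSingle i k⁆ = -skewSingle j k := by
    ext1
    rw [coe_lie]
    change (Matrix.single i j (1 : ℝ) - Matrix.single j i 1) *
      (Matrix.single i k 1 - Matrix.single k i 1) - (Matrix.single i k 1 - Matrix.single k i 1) *
      (Matrix.single i j 1 - Matrix.single j i 1) = -(Matrix.single j k 1 - Matrix.single k j 1)
    simp [mul_sub, sub_mul, hij, hjk, hik, hij.symm, hjk.symm, hik.symm]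
    abel
  have h1 := form_lie_add_form_lie_eq_zero h.1 hW (skewSingle j k) (skewSingle i k)
  rw [e1, e2, map_neg, weightedForm_skewSingle_self w hw hik,
    weightedForm_skewSingle_self w hw hjk] at h1
  linarith

/-! ### Block diagonal rotations -/

variable {κ : Type*}

/-- The entries of `M` vanish outside the diagonal blocks given by the fibres of `f`. -/
def IsBlockDiag (f : Fin n → κ) (M : Matrix (Fin n) (Fin n) ℝ) : Prop :=
  ∀ i j, f i ≠ f j → M i j = 0

/-- A matrix is block diagonal if and only if it commutes with the projections to the blocks; in
this form the property visibly passes to the exponential. -/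
theorem isBlockDiag_iff_commute [DecidableEq κ] {f : Fin n → κ} {M : Matrix (Fin n) (Fin n) ℝ} :
    IsBlockDiag f M ↔
      ∀ a, Commute M (Matrix.diagonal fun i => if f i = a then (1 : ℝ) else 0) := by
  constructor
  · intro h a
    ext i j
    rw [Matrix.mul_diagonal, Matrix.diagonal_mul]
    by_cases hij : f i = f j
    · rw [hij, mul_comm]
    · rw [h i j hij, zero_mul, mul_zero]
  · intro h i j hij
    have := congrFun (congrFun (h (f j)).eq i) j
    rw [Matrix.mul_diagonal, Matrix.diagonal_mul] at this
    simpa [hij] using this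

open scoped Matrix.Norms.L2Operator in
theorem IsBlockDiag.exp [DecidableEq κ] {f : Fin n → κ} {M : Matrix (Fin n) (Fin n) ℝ}
    (h : IsBlockDiag f M) : IsBlockDiag f (NormedSpace.exp M) :=
  isBlockDiag_iff_commute.2 fun a => (isBlockDiag_iff_commute.1 h a).exp_left

theorem exp_mem_specialOrthogonalGroup (X : so n) :
    NormedSpace.exp X.1 ∈ Matrix.specialOrthogonalGroup (Fin n) ℝ := by
  have ho : ∀ Y : so n, NormedSpace.exp Y.1 * (NormedSpace.exp Y.1)ᵀ = 1 := fun Y => by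
    rw [← Matrix.exp_transpose, so_transpose,
      ← Matrix.exp_add_of_commute _ _ (Commute.refl Y.1).neg_right, add_neg_cancel,
      NormedSpace.exp_zero]
  refine Matrix.mem_specialOrthogonalGroup_iff.2
    ⟨(Matrix.mem_orthogonalGroup_iff (Fin n) ℝ).2 (ho X), ?_⟩
  -- the determinant is a square, because `exp X = exp (X / 2) ^ 2`
  have hsq : NormedSpace.exp X.1 =
      NormedSpace.exp ((2⁻¹ : ℝ) • X).1 * NormedSpace.exp ((2⁻¹ : ℝ) • X).1 := by
    rw [← Matrix.exp_add_of_commute _ _ (Commute.refl _)]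
    congr 1
    change X.1 = (2⁻¹ : ℝ) • X.1 + (2⁻¹ : ℝ) • X.1
    rw [← add_smul]
    norm_num
  have hdet := congrArg Matrix.det (ho ((2⁻¹ : ℝ) • X))
  rw [Matrix.det_mul, Matrix.det_transpose, Matrix.det_one] at hdet
  rw [hsq, Matrix.det_mul, hdet]

/-- The subgroup of `SO(n)` of the rotations which are block diagonal with respect to the fibres
of `f`. -/
def blockDiagSubgroup (f : Fin n → κ) : Subgroup (SO n) where
  carrier := {g | IsBlockDiag f g.1}
  one_mem' i j hij := Matrix.one_apply_ne fun h => hij (congrArg f h)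
  mul_mem' {g h} hg hh i j hij := by
    change (g.1 * h.1) i j = 0
    rw [Matrix.mul_apply]
    refine Finset.sum_eq_zero fun a _ => ?_
    by_cases ha : f i = f a
    · rw [hh a j (ha ▸ hij), mul_zero]
    · rw [hg i a ha, zero_mul]
  inv_mem' {g} hg i j hij := hg j i hij.symm

theorem isClosed_blockDiagSubgroup (f : Fin n → κ) :
    IsClosed (blockDiagSubgroup f : Set (SO n)) := by
  have : (blockDiagSubgroup f : Set (SO n)) =
      ⋂ i, ⋂ j, ⋂ _ : f i ≠ f j, {g : SO n | g.1 i j = 0} := by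
    ext g
    simp only [Set.mem_iInter]
    rfl
  rw [this]
  refine isClosed_iInter fun i => isClosed_iInter fun j => isClosed_iInter fun _ => ?_
  exact isClosed_eq (continuous_subtype_val.matrix_elem i j) continuous_const

theorem expMem_blockDiagSubgroup {f : Fin n → κ} {X : so n} (hX : IsBlockDiag f X.1) :
    ExpMem (blockDiagSubgroup f) X := fun t => by
  classical
  refine ⟨⟨NormedSpace.exp (t • X).1, exp_mem_specialOrthogonalGroup (t • X)⟩, ?_, rfl⟩
  refine IsBlockDiag.exp fun i j hij => ?_
  change t * X.1 i j = 0
  rw [hX i j hij, mul_zero]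

/-- If `wᵢⱼ` depends only on the blocks of `i` and `j`, then the entrywise multiplication by `w`
commutes with the conjugation by block diagonal rotations. -/
theorem Ad_scale {f : Fin n → κ} {w : Fin n → Fin n → ℝ} (hw : ∀ i j, w i j = w j i)
    (hf : ∀ i j i' j', f i = f i' → f j = f j' → w i j = w i' j') {l : SO n}
    (hl : l ∈ blockDiagSubgroup f) (X : so n) : Ad l (scale w hw X) = scale w hw (Ad l X) := by
  ext i j
  rw [scale_apply]
  change (l.1 * (scale w hw X).1 * l.1ᵀ) i j = w i j * (l.1 * X.1 * l.1ᵀ) i j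
  rw [Matrix.mul_apply, Matrix.mul_apply, Finset.mul_sum]
  refine Finset.sum_congr rfl fun b _ => ?_
  rw [Matrix.mul_apply, Matrix.mul_apply, Finset.sum_mul, Finset.sum_mul, Finset.mul_sum]
  refine Finset.sum_congr rfl fun a _ => ?_
  rw [scale_apply, Matrix.transpose_apply]
  by_cases ha : f i = f a
  · by_cases hb : f j = f b
    · rw [hf i j a b ha hb]
      ring
    · rw [hl j b hb]
      ring
  · rw [hl i a ha]
    ring

theorem trace_Ad_mul_Ad (l : SO n) (X Y : so n) :
    ((Ad l X).1 * (Ad l Y).1).trace = (X.1 * Y.1).trace := by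
  change (l.1 * X.1 * l.1ᵀ * (l.1 * Y.1 * l.1ᵀ)).trace = _
  have : l.1 * X.1 * l.1ᵀ * (l.1 * Y.1 * l.1ᵀ) = l.1 * (X.1 * Y.1 * l.1ᵀ) := by
    simp only [mul_assoc]
    rw [← mul_assoc l.1ᵀ l.1, SO.transpose_mul_self, one_mul]
  rw [this, Matrix.trace_mul_comm, mul_assoc, SO.transpose_mul_self, mul_one]

/-! ### Naturally reductive weighted scalar products -/

theorem mem_isotropy_iff {𝔩 : LieSubalgebra ℝ (so n)} {p : so n × 𝔩} :
    p ∈ isotropy 𝔩 ↔ orbitMap 𝔩 p = 0 := by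
  refine ⟨orbitMap_isotropy, fun h => ⟨p.2, ?_⟩⟩
  exact Prod.ext (sub_eq_zero.1 h).symm rfl

theorem isCompl_range_isotropy {𝔩 : LieSubalgebra ℝ (so n)} {ι : so n →ₗ[ℝ] so n × 𝔩}
    (hι : ∀ X, orbitMap 𝔩 (ι X) = X) : IsCompl (LinearMap.range ι) (isotropy 𝔩) := by
  refine ⟨?_, ?_⟩
  · rw [Submodule.disjoint_def]
    rintro _ ⟨X, rfl⟩ h
    rw [mem_isotropy_iff, hι] at h
    rw [h, map_zero]
  · rw [Submodule.codisjoint_iff_exists_add_eq]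
    intro p
    refine ⟨ι (orbitMap 𝔩 p), p - ι (orbitMap 𝔩 p), ⟨_, rfl⟩, ?_, add_sub_cancel _ _⟩
    rw [mem_isotropy_iff, map_sub, hι, sub_self]

/-- If `wᵢⱼ` depends only on the blocks of `i` and `j`, with the constant value `m` off the diagonal
blocks, then the metric is naturally reductive with respect to `SO(n) × L`, where `L` consists of
the block diagonal rotations. The complement of the isotropy algebra is the set of all
`(m⁻¹ΛX, m⁻¹ΛX - X)`, where `Λ` is the entrywise multiplication by `w`; the constancy of `w` off the
diagonal blocks makes the second component block diagonal. -/
theorem isNaturallyReductive_weightedForm {f : Fin n → κ} {w : Fin n → Fin n → ℝ}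
    (hw : ∀ i j, w i j = w j i) (hf : ∀ i j i' j', f i = f i' → f j = f j' → w i j = w i' j')
    {m : ℝ} (hm : m ≠ 0) (hfm : ∀ i j, f i ≠ f j → w i j = m) :
    IsNaturallyReductive (weightedForm w) (blockDiagSubgroup f) (isClosed_blockDiagSubgroup f) := by
  have hinv : ∀ l ∈ blockDiagSubgroup f, ∀ X Y : so n,
      weightedForm w (Ad l X) (Ad l Y) = weightedForm w X Y := fun l hl X Y => by
    rw [weightedForm_eq_trace_left w hw, ← Ad_scale hw hf hl, trace_Ad_mul_Ad,
      ← weightedForm_eq_trace_left]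
  refine ⟨hinv, ?_⟩
  set ψ : so n →ₗ[ℝ] so n := m⁻¹ • scale w hw with hψ
  have hexp : ∀ X, ExpMem (blockDiagSubgroup f) (ψ X - X) := fun X =>
    expMem_blockDiagSubgroup fun i j hij => by
      change m⁻¹ * (w i j * X.1 i j) - X.1 i j = 0
      rw [hfm i j hij, inv_mul_cancel_left₀ hm, sub_self]
  set φ : so n →ₗ[ℝ] lieAlgebra _ (isClosed_blockDiagSubgroup f) :=
    (ψ - LinearMap.id).codRestrict (lieAlgebra _ (isClosed_blockDiagSubgroup f)).toSubmodule hexp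
    with hφ
  have hAd : ∀ l ∈ blockDiagSubgroup f, ∀ X, Ad l (ψ X) = ψ (Ad l X) := fun l hl X => by
    rw [hψ, LinearMap.smul_apply, LinearMap.smul_apply, map_smul, Ad_scale hw hf hl]
  have hι : ∀ X, orbitMap _ (ψ.prod φ X) = X := fun X => sub_sub_cancel (ψ X) X
  refine ⟨LinearMap.range (ψ.prod φ), isCompl_range_isotropy hι, ?_, ?_⟩
  · rintro l _ ⟨X, rfl⟩
    refine ⟨Ad (l : SO n) X, ?_⟩
    refine Prod.ext (hAd l l.2 X).symm (Subtype.ext ?_)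
    change ψ (Ad (l : SO n) X) - Ad (l : SO n) X = Ad (l : SO n) (ψ X - X)
    rw [map_sub, hAd l l.2]
  · rw [naturalReductivityIdentity_iff]
    rintro _ ⟨X, rfl⟩ _ ⟨Y, rfl⟩ _ ⟨Z, rfl⟩
    have hbr : ∀ X Y, orbitMap _ ⁅ψ.prod φ X, ψ.prod φ Y⁆ = ⁅X, ψ Y⁆ + ⁅ψ X - X, Y⁆ := fun X Y => by
      change ⁅ψ X, ψ Y⁆ - ⁅ψ X - X, ψ Y - Y⁆ = _
      simp only [sub_lie, lie_sub]
      abel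
    rw [hbr, hbr, hι, hι]
    have h2 := form_lie_add_form_lie_eq_zero hinv (hexp X) Y Z
    have h3 : weightedForm w ⁅X, ψ Y⁆ Z + weightedForm w Y ⁅X, ψ Z⁆ = 0 := by
      rw [hψ, LinearMap.smul_apply, LinearMap.smul_apply, lie_smul, lie_smul, map_smul, map_smul,
        LinearMap.smul_apply, weightedForm_eq_trace_right w hw, weightedForm_eq_trace_left w hw,
        Matrix.trace_mul_comm (scale w hw Y).1, trace_lie_mul, trace_lie_mul,
        ← lie_skew (scale w hw Z)]
      change m⁻¹ * -(X.1 * _).trace + m⁻¹ * -(X.1 * -_).trace = 0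
      rw [mul_neg X.1, Matrix.trace_neg]
      ring
    simp only [map_add, LinearMap.add_apply]
    linarith

/-! ### The block metrics on `𝔰𝔬(k₁ + k₂ + k₃)` -/

/-- The factors of the scalar product on the six summands, as a symmetric matrix. -/
def blockWeight (x₁ x₂ x₃ x₁₂ x₁₃ x₂₃ : ℝ) : Matrix (Fin 3) (Fin 3) ℝ :=
  !![x₁, x₁₂, x₁₃; x₁₂, x₂, x₂₃; x₁₃, x₂₃, x₃]

theorem blockMetric_eq_weightedForm (k₁ k₂ k₃ : ℕ) (x₁ x₂ x₃ x₁₂ x₁₃ x₂₃ : ℝ) :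
    blockMetric k₁ k₂ k₃ x₁ x₂ x₃ x₁₂ x₁₃ x₂₃ = weightedForm fun i j =>
      (((k₁ + k₂ + k₃ : ℕ) : ℝ) - 2) *
        blockWeight x₁ x₂ x₃ x₁₂ x₁₃ x₂₃ (block k₁ k₂ i) (block k₁ k₂ j) := by
  have hform : ∀ a b X Y, blockForm k₁ k₂ k₃ a b X Y = ∑ i, ∑ j,
      if (block k₁ k₂ i = a ∧ block k₁ k₂ j = b) ∨ (block k₁ k₂ i = b ∧ block k₁ k₂ j = a) then
        (((k₁ + k₂ + k₃ : ℕ) : ℝ) - 2) * (X.1 i j * Y.1 i j) else 0 := fun a b X Y => by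
    change -(killingForm ℝ (so (k₁ + k₂ + k₃)) (blockProj k₁ k₂ k₃ a b X)
      (blockProj k₁ k₂ k₃ a b Y)) = _
    rw [killingForm_so, trace_mul_so, mul_neg, neg_neg, Finset.mul_sum]
    refine Finset.sum_congr rfl fun i _ => ?_
    rw [Finset.mul_sum]
    refine Finset.sum_congr rfl fun j _ => ?_
    change _ * ((if _ then X.1 i j else 0) * (if _ then Y.1 i j else 0)) = _
    split_ifs
    · rfl
    · rw [mul_zero, mul_zero]
  ext X Y
  simp only [blockMetric, LinearMap.add_apply, LinearMap.smul_apply, hform, weightedForm_apply,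
    smul_eq_mul, Finset.mul_sum, ← Finset.sum_add_distrib]
  refine Finset.sum_congr rfl fun i _ => Finset.sum_congr rfl fun j _ => ?_
  generalize block k₁ k₂ i = a, block k₁ k₂ j = b
  fin_cases a <;> fin_cases b <;> simp [blockWeight] <;> ring

theorem exists_pair_block {k₁ k₂ k₃ : ℕ} (hk₁ : 2 ≤ k₁) (hk₂ : 2 ≤ k₂) (hk₃ : 2 ≤ k₃)
    (a : Fin 3) : ∃ i j : Fin (k₁ + k₂ + k₃), i ≠ j ∧ block k₁ k₂ i = a ∧ block k₁ k₂ j = a := by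
  fin_cases a
  · refine ⟨⟨0, by omega⟩, ⟨1, by omega⟩, by simp, ?_, ?_⟩ <;>
      simp only [block] <;> grind
  · refine ⟨⟨k₁, by omega⟩, ⟨k₁ + 1, by omega⟩, by simp, ?_, ?_⟩ <;>
      simp only [block] <;> grind
  · refine ⟨⟨k₁ + k₂, by omega⟩, ⟨k₁ + k₂ + 1, by omega⟩, by simp, ?_, ?_⟩ <;>
      simp only [block] <;> grind

end SOMetric

open SOMetric in
theorem proposition4p2 (k₁ k₂ k₃ : ℕ) (hk₁ : 2 ≤ k₁) (hk₂ : 2 ≤ k₂) (hk₃ : 2 ≤ k₃)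
    (x₁ x₂ x₃ x₁₂ x₁₃ x₂₃ : ℝ) (hx₁ : 0 < x₁) (hx₂ : 0 < x₂) (hx₃ : 0 < x₃)
    (hx₁₂ : 0 < x₁₂) (hx₁₃ : 0 < x₁₃) (hx₂₃ : 0 < x₂₃) :
    (∃ (L : Subgroup (SOMetric.SO (k₁ + k₂ + k₃)))
        (hL : IsClosed (L : Set (SOMetric.SO (k₁ + k₂ + k₃)))),
        SOMetric.IsNaturallyReductive
          (SOMetric.blockMetric k₁ k₂ k₃ x₁ x₂ x₃ x₁₂ x₁₃ x₂₃) L hL) ↔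
      ((x₁ = x₂ ∧ x₂ = x₁₂ ∧ x₁₃ = x₂₃) ∨
        (x₂ = x₃ ∧ x₃ = x₂₃ ∧ x₁₂ = x₁₃) ∨
        (x₁ = x₃ ∧ x₃ = x₁₃ ∧ x₁₂ = x₂₃) ∨
        (x₁₂ = x₁₃ ∧ x₁₃ = x₂₃)) := by
  rw [blockMetric_eq_weightedForm]
  have hn : (0 : ℝ) < ((k₁ + k₂ + k₃ : ℕ) : ℝ) - 2 := by
    have : (6 : ℝ) ≤ ((k₁ + k₂ + k₃ : ℕ) : ℝ) := by exact_mod_cast (by omega)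
    linarith
  set v := blockWeight x₁ x₂ x₃ x₁₂ x₁₃ x₂₃ with hv
  have hsymm : ∀ a b, v a b = v b a := by
    intro a b; fin_cases a <;> fin_cases b <;> rfl
  have hpos : ∀ a b, 0 < v a b := by
    intro a b; fin_cases a <;> fin_cases b <;> assumption
  constructor
  · rintro ⟨L, hL, h⟩
    obtain ⟨c, hc⟩ := h.weight_eq (by omega) (fun i j => by rw [hsymm])
      (fun i j => mul_pos hn (hpos _ _))
    -- As every block has two elements, `k` can be chosen in any block, distinct from `i` and `j`.
    have key : ∀ a b d, a ≠ b → (c * (((k₁ + k₂ + k₃ : ℕ) : ℝ) - 2)) * v a b ≠ 1 →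
        v a d = v b d := by
      intro a b d hab hne
      obtain ⟨i, i', hii, rfl, hi'⟩ := exists_pair_block hk₁ hk₂ hk₃ a
      obtain ⟨j, j', hjj, rfl, hj'⟩ := exists_pair_block hk₁ hk₂ hk₃ b
      obtain ⟨k, hk, hik, hjk⟩ : ∃ k, block k₁ k₂ k = d ∧ i ≠ k ∧ j ≠ k := by
        by_cases hdi : block k₁ k₂ i = d
        · exact ⟨i', hi'.trans hdi, hii, fun h => hab (by rw [h, hi'])⟩
        by_cases hdj : block k₁ k₂ j = d
        · exact ⟨j', hj'.trans hdj, fun h => hab (by rw [h, hj']), hjj⟩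
        obtain ⟨k, -, -, hk, -⟩ := exists_pair_block hk₁ hk₂ hk₃ d
        exact ⟨k, hk, fun h => hdi (h ▸ hk), fun h => hdj (h ▸ hk)⟩
      subst hk
      have := hc i j k (fun h => hab (by rw [h])) hjk hik (by rwa [← mul_assoc])
      exact mul_left_cancel₀ hn.ne' this
    set c' := c * (((k₁ + k₂ + k₃ : ℕ) : ℝ) - 2)
    by_cases h12 : c' * x₁₂ = 1
    · by_cases h13 : c' * x₁₃ = 1
      · by_cases h23 : c' * x₂₃ = 1
        · have hc0 : c' ≠ 0 := left_ne_zero_of_mul_eq_one h12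
          exact Or.inr (Or.inr (Or.inr ⟨mul_left_cancel₀ hc0 (h12.trans h13.symm),
            mul_left_cancel₀ hc0 (h13.trans h23.symm)⟩))
        · have e0 : x₁₂ = x₁₃ := key 1 2 0 (by decide) h23
          have e1 : x₂ = x₂₃ := key 1 2 1 (by decide) h23
          have e2 : x₂₃ = x₃ := key 1 2 2 (by decide) h23
          exact Or.inr (Or.inl ⟨e1.trans e2, e2.symm, e0⟩)
      · have e0 : x₁ = x₁₃ := key 0 2 0 (by decide) h13
        have e1 : x₁₂ = x₂₃ := key 0 2 1 (by decide) h13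
        have e2 : x₁₃ = x₃ := key 0 2 2 (by decide) h13
        exact Or.inr (Or.inr (Or.inl ⟨e0.trans e2, e2.symm, e1⟩))
    · have e0 : x₁ = x₁₂ := key 0 1 0 (by decide) h12
      have e1 : x₁₂ = x₂ := key 0 1 1 (by decide) h12
      have e2 : x₁₃ = x₂₃ := key 0 1 2 (by decide) h12
      exact Or.inl ⟨e0.trans e1, e1.symm, e2⟩
  -- `σ` merges some of the three blocks; `m` is the common factor off the merged diagonal blocks
  · have main : ∀ (σ : Fin 3 → Fin 3) (m : ℝ), 0 < m →
        (∀ a b a' b', σ a = σ a' → σ b = σ b' → v a b = v a' b') →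
        (∀ a b, σ a ≠ σ b → v a b = m) → ∃ (L : Subgroup (SO (k₁ + k₂ + k₃)))
          (hL : IsClosed (L : Set (SO (k₁ + k₂ + k₃)))), IsNaturallyReductive
          (weightedForm fun i j => (((k₁ + k₂ + k₃ : ℕ) : ℝ) - 2) *
            v (block k₁ k₂ i) (block k₁ k₂ j)) L hL := by
      intro σ m hm h1 h2
      refine ⟨_, _, isNaturallyReductive_weightedForm (f := fun i => σ (block k₁ k₂ i))
        (m := (((k₁ + k₂ + k₃ : ℕ) : ℝ) - 2) * m) (fun i j => by rw [hsymm])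
        (fun i j i' j' hi hj => by rw [h1 _ _ _ _ hi hj]) (mul_pos hn hm).ne'
        (fun i j hij => by rw [h2 _ _ hij])⟩
    rintro (⟨rfl, rfl, rfl⟩ | ⟨rfl, rfl, rfl⟩ | ⟨rfl, rfl, rfl⟩ | ⟨rfl, rfl⟩)
    · refine main ![0, 0, 1] x₁₃ hx₁₃ ?_ ?_ <;> simp [Fin.forall_fin_succ, hv, blockWeight]
    · refine main ![0, 1, 1] x₁₂ hx₁₂ ?_ ?_ <;> simp [Fin.forall_fin_succ, hv, blockWeight]
    · refine main ![0, 1, 0] x₁₂ hx₁₂ ?_ ?_ <;> simp [Fin.forall_fin_succ, hv, blockWeight]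
    · refine main id x₁₂ hx₁₂ ?_ ?_
      · rintro a b _ _ rfl rfl
        rfl
      · simp [Fin.forall_fin_succ, hv, blockWeight]
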